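/- Let $S$ be a finite inverse semigroup, i.e. a finite semigroup in which every $x$ has exactly one $x^{-1}\in S$ with $xx^{-1}x=x$ and $x^{-1}xx^{-1}=x^{-1}$. Write $s\le t$ (natural partial order) if $s=et$ for some idempotent $e\in S$, let $\mu$ be the Möbius function of this order, and call $s,t\in S$ $\mathcal D$-related if there is $x\in S$ with $x^{-1}x=ss^{-1}$ and $xx^{-1}=tt^{-1}$. For $t\in S$ let $r(t)$ be the number of idempotents in the $\mathcal D$-class of $t$, and let $G(t)$ be the maximal subgroup of $S$ at an idempotent $e_t$ of that $\mathcal D$-class, where $e_t$ may be chosen arbitrarily (that is, $G(t)$ is a subset of $S$ that is a group under the operation of $S$ with identity $e_t$ and is not properly contained in another such subset). A representation of the semigroup algebra $\mathbb{C}S$ is an algebra homomorphism $\rho:\mathbb{C}S\to M_{d_\rho}(\mathbb{C})$, $d_\rho\in\mathbb{N}$; it is irreducible if it is nonzero and $\mathbb{C}^{d_\rho}$ has no invariant subspace other than $0$ and $\mathbb{C}^{d_\rho}$; representations $\rho,\sigma$ are equivalent if $\sigma=A\rho A^{-1}$ for some invertible matrix $A$. Let $\mathcal{X}$ be any complete set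 of inequivalent irreducible representations of $\mathbb{C}S$, i.e. a set of irreducible representations containing exactly one representative of each equivalence class of irreducible representations. For $f=\sum_{s\in S}f(s)s\in\mathbb{C}S$ put $\hat f(\rho)=\rho(f)=\sum_{s\in S}f(s)\rho(s)$. Then $\mathcal{X}$ is finite, and for every $f=\sum_{s\in S}f(s)s\in\mathbb{C}S$ and every $s\in S$, \[ f(s)=\sum_{\rho\in\mathcal{X}}d_\rho\sum_{t\in S:\,t\ge s}\frac{\mu(s,t)}{r(t)\,|G(t)|}\sum_{v\in S:\,v^{-1}\le t^{-1}}\mu(v^{-1},t^{-1})\,\operatorname{tr}\!\left(\hat f(\rho)\,\rho(v^{-1})\right). \] -/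

import Mathlib

/-- A semigroup `S` is an inverse semigroup if every `x` has exactly one `y` with
`x y x = x` and `y x y = y`. -/
class IsInverseSemigroup (S : Type*) [Semigroup S] : Prop where
  existsUnique_inverse : ∀ x : S, ∃! y : S, x * y * x = x ∧ y * x * y = y

namespace InverseSemigroup

section Order

variable {S : Type*} [Semigroup S]

/-- The natural partial order: `t ≤ s` iff `t = e s` for some idempotent `e`. -/
def NatLE (t s : S) : Prop := ∃ e : S, IsIdempotentElem e ∧ t = e * s

variable [IsInverseSemigroup S]

/-- The inverse `x⁻¹` of an element of an inverse semigroup. -/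
noncomputable def sinv (x : S) : S :=
  (IsInverseSemigroup.existsUnique_inverse x).choose

theorem mul_sinv_mul (x : S) : x * sinv x * x = x :=
  (IsInverseSemigroup.existsUnique_inverse x).choose_spec.1.1

theorem sinv_mul_sinv (x : S) : sinv x * x * sinv x = sinv x :=
  (IsInverseSemigroup.existsUnique_inverse x).choose_spec.1.2

theorem eq_sinv {x y : S} (h₁ : x * y * x = x) (h₂ : y * x * y = y) : y = sinv x :=
  (IsInverseSemigroup.existsUnique_inverse x).choose_spec.2 y ⟨h₁, h₂⟩

theorem idem_mul_idem {e f : S} (he : IsIdempotentElem e) (hf : IsIdempotentElem f) :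
    IsIdempotentElem (e * f) := by
  have he' : ∀ z : S, e * (e * z) = e * z := fun z => by rw [← mul_assoc, he.eq]
  have hf' : ∀ z : S, f * (f * z) = f * z := fun z => by rw [← mul_assoc, hf.eq]
  obtain ⟨x, hx⟩ : ∃ x, x = sinv (e * f) := ⟨_, rfl⟩
  have h₁ : e * f * x * (e * f) = e * f := by rw [hx]; exact mul_sinv_mul _
  have h₂ : x * (e * f) * x = x := by rw [hx]; exact sinv_mul_sinv _
  have h₂' : ∀ z : S, x * (e * (f * (x * z))) = x * z := fun z => by
    conv_rhs => rw [← h₂]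
    simp only [mul_assoc]
  have h₃ : f * x * e = x := by
    rw [hx]
    rw [← hx]
    refine (eq_sinv (x := e * f) ?_ ?_).trans hx.symm
    · simp only [mul_assoc] at h₁ ⊢
      rw [he', hf', h₁]
    · simp only [mul_assoc]
      rw [he', hf', h₂']
  have h₄ : x * x = x := by
    calc x * x = f * x * e * (f * x * e) := by rw [h₃]
      _ = f * x * e := by simp only [mul_assoc]; rw [h₂']
      _ = x := h₃
  have h₅ : x = sinv x := eq_sinv (by rw [h₄, h₄]) (by rw [h₄, h₄])
  have h₆ : e * f = sinv x := eq_sinv h₂ h₁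
  rw [h₆, ← h₅]
  exact h₄

theorem idem_comm {e f : S} (he : IsIdempotentElem e) (hf : IsIdempotentElem f) :
    e * f = f * e := by
  have he' : ∀ z : S, e * (e * z) = e * z := fun z => by rw [← mul_assoc, he.eq]
  have hf' : ∀ z : S, f * (f * z) = f * z := fun z => by rw [← mul_assoc, hf.eq]
  have h := (idem_mul_idem he hf).eq
  have h' := (idem_mul_idem hf he).eq
  have h₁ : e * f = sinv (e * f) := eq_sinv (by rw [h, h]) (by rw [h, h])
  have h₂ : f * e = sinv (e * f) := by
    apply eq_sinv
    · simp only [mul_assoc] at h ⊢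
      rw [hf', he', h]
    · simp only [mul_assoc] at h' ⊢
      rw [he', hf', h']
  rw [h₁, ← h₂]

/-- The natural partial order, bundled (not a global instance, since `S` may carry other orders). -/
abbrev naturalOrder (S : Type*) [Semigroup S] [IsInverseSemigroup S] : PartialOrder S where
  le := NatLE
  le_refl s := ⟨s * sinv s, by
    change s * sinv s * (s * sinv s) = s * sinv s
    rw [← mul_assoc, mul_sinv_mul], (mul_sinv_mul s).symm⟩
  le_trans := by
    rintro a b c ⟨e, he, rfl⟩ ⟨f, hf, rfl⟩
    exact ⟨e * f, idem_mul_idem he hf, (mul_assoc _ _ _).symm⟩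
  le_antisymm := by
    rintro a b ⟨e, he, hab⟩ ⟨f, hf, hba⟩
    calc a = e * b := hab
      _ = e * (f * a) := by rw [← hba]
      _ = f * (e * a) := by rw [← mul_assoc, idem_comm he hf, mul_assoc]
      _ = f * a := by
        congr 1
        rw [hab, ← mul_assoc, he.eq]
      _ = b := hba.symm

noncomputable instance decidableNatLE : DecidableRel (NatLE : S → S → Prop) := Classical.decRel _

/-- The Möbius function of the natural partial order of a finite inverse semigroup. -/
noncomputable def moebius [Fintype S] (s t : S) : ℂ :=
  letI : PartialOrder S := naturalOrder S
  letI : DecidableEq S := Classical.decEq S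
  letI : DecidableLE S := Classical.decRel _
  letI : DecidableLT S := Classical.decRel _
  letI : LocallyFiniteOrder S := Fintype.toLocallyFiniteOrder
  IncidenceAlgebra.mu ℂ s t

/-- `dom s = s⁻¹ s`. -/
noncomputable def dom (s : S) : S := sinv s * s

/-- `ran s = s s⁻¹`. -/
noncomputable def ran (s : S) : S := s * sinv s

/-- Green's `𝒟`-relation. -/
def DRel (s t : S) : Prop := ∃ x : S, dom x = ran s ∧ ran x = ran t

/-- The number of idempotents in the `𝒟`-class of `t`. -/
noncomputable def numIdem (t : S) : ℕ := {e : S | IsIdempotentElem e ∧ DRel t e}.ncard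

end Order

section Subgroups

variable {S : Type*} [Semigroup S]

/-- `G` is a group under the operation of `S`, with identity element `e`. -/
structure IsSubgroupAt (e : S) (G : Set S) : Prop where
  one_mem : e ∈ G
  mul_mem : ∀ g ∈ G, ∀ h ∈ G, g * h ∈ G
  one_mul : ∀ g ∈ G, e * g = g
  mul_one : ∀ g ∈ G, g * e = g
  exists_inv : ∀ g ∈ G, ∃ h ∈ G, g * h = e ∧ h * g = e

/-- `G` is a subgroup of the semigroup `S`: a subset that is a group under the operation of `S`. -/
def IsSubgroup (G : Set S) : Prop := ∃ e : S, IsSubgroupAt e G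

/-- `G` is the maximal subgroup of `S` at `e`: a subgroup with identity `e` that is not properly
contained in any other subgroup of `S`. -/
def IsMaximalSubgroupAt (e : S) (G : Set S) : Prop :=
  IsSubgroupAt e G ∧ Maximal IsSubgroup G

end Subgroups

/-- A matrix representation of `ℂS`: an algebra homomorphism `ℂS → M_n(ℂ)`. As `ℂS` carries no
unit in Mathlib, the homomorphism is not required to be unital; for irreducible (in particular
nonzero) representations this is automatic. -/
structure MatRep (S : Type*) [Semigroup S] where
  /-- The dimension `d_ρ`. -/
  dim : ℕ
  /-- The underlying algebra homomorphism. -/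
  hom : MonoidAlgebra ℂ S →ₙₐ[ℂ] Matrix (Fin dim) (Fin dim) ℂ

namespace MatRep

variable {S : Type*} [Semigroup S]

/-- The Fourier transform of `f` at `ρ`, `ρ(f) = ∑ f(s) ρ(s)`. -/
noncomputable def fourier (f : MonoidAlgebra ℂ S) (ρ : MatRep S) :
    Matrix (Fin ρ.dim) (Fin ρ.dim) ℂ := ρ.hom f

/-- The value `ρ(s)` at a semigroup element. -/
noncomputable def val (ρ : MatRep S) (s : S) : Matrix (Fin ρ.dim) (Fin ρ.dim) ℂ :=
  ρ.hom (MonoidAlgebra.single s 1)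

/-- Equivalence: `σ = A ρ A⁻¹` for an invertible matrix `A`, with inverse `B`. -/
def Equivalent (ρ σ : MatRep S) : Prop :=
  ∃ (A : Matrix (Fin σ.dim) (Fin ρ.dim) ℂ) (B : Matrix (Fin ρ.dim) (Fin σ.dim) ℂ),
    A * B = 1 ∧ B * A = 1 ∧ ∀ a : MonoidAlgebra ℂ S, σ.hom a = A * ρ.hom a * B

/-- Irreducibility: `ρ` is nonzero and `ℂ^{d_ρ}` has no nontrivial invariant subspace. -/
def Irreducible (ρ : MatRep S) : Prop :=
  ρ.hom ≠ 0 ∧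
    ∀ W : Submodule ℂ (Fin ρ.dim → ℂ),
      (∀ a : MonoidAlgebra ℂ S, ∀ w ∈ W, (ρ.hom a).mulVec w ∈ W) → W = ⊥ ∨ W = ⊤

/-- `X` is a complete set of inequivalent irreducible representations of `ℂS`. -/
structure IsCompleteSet (X : Set (MatRep S)) : Prop where
  irreducible : ∀ ρ ∈ X, Irreducible ρ
  inequivalent : ∀ ρ ∈ X, ∀ σ ∈ X, Equivalent ρ σ → ρ = σ
  complete : ∀ σ : MatRep S, Irreducible σ → ∃ ρ ∈ X, Equivalent σ ρ

end MatRep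

end InverseSemigroup

namespace InverseSemigroup

/-! ### Regular trace of a product of matrix algebras. -/

section MatrixProducts

variable {ι : Type*} [Fintype ι] {d : ι → ℕ}

/-! Write ⌊u⌋ = ∑_{v ≤ u} μ(v,u) v. By Möbius inversion these elements form a basis of ℂS, the
⌊t⌋-coordinate of f is F(t) = ∑_{s ≥ t} f(s), and f(s) = ∑_{t ≥ s} μ(s,t) F(t). It remains to
express F(t) through traces. In this basis ℂS behaves like the algebra of a groupoid: s⌊u⌋ is ⌊su⌋
or 0 (`single_mul_moebiusBasis`). So the trace τ of the left regular representation vanishes on ⌊c⌋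
unless c is idempotent, and τ(f⌊t⁻¹⌋) = N(t) F(t), where N(t) counts the u with uu⁻¹ = tt⁻¹
(`regularTrace_mul_moebiusBasis_sinv`). Sorting these u by u⁻¹u gives N(t) = r(t)|G(t)|
(`card_ran_eq`). Since N(t) ≠ 0, the trace form is nondegenerate, so ℂS is a product of matrix
algebras. Its blocks represent the irreducible classes, whence τ = ∑ d_ρ tr ρ
(`exists_finite_sum_trace_eq_regularTrace`). Evaluating at f⌊t⁻¹⌋ gives F(t). -/

theorem trace_mulLeft_pi_matrix (M : Π i, Matrix (Fin (d i)) (Fin (d i)) ℂ) :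
    LinearMap.trace ℂ (Π i, Matrix (Fin (d i)) (Fin (d i)) ℂ) (LinearMap.mulLeft ℂ M) =
      ∑ i, (d i : ℂ) * (M i).trace := by
  classical
  rw [LinearMap.trace_eq_matrix_trace ℂ
    (Pi.basis fun i => Matrix.stdBasis ℂ (Fin (d i)) (Fin (d i)))]
  rw [Matrix.trace, Fintype.sum_sigma]
  refine Finset.sum_congr rfl fun i _ => ?_
  rw [Fintype.sum_prod_type_right]
  -- Each column `k` of block `i` is acted on by `M i`, so the diagonal entry is independent of `k`;
  -- the sum over `k` yields the factor `d i`.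
  have h : ∀ j k : Fin (d i), (LinearMap.toMatrix
      (Pi.basis fun i => Matrix.stdBasis ℂ (Fin (d i)) (Fin (d i)))
      (Pi.basis fun i => Matrix.stdBasis ℂ (Fin (d i)) (Fin (d i)))
      (LinearMap.mulLeft ℂ M)).diag ⟨i, (j, k)⟩ = M i j j := by
    intro j k
    rw [Matrix.diag_apply, LinearMap.toMatrix_apply, Pi.basis_repr, Pi.basis_apply,
      LinearMap.mulLeft_apply, Pi.mul_apply, Pi.single_eq_same, Matrix.stdBasis_eq_single]
    change (M i * Matrix.single j k (1 : ℂ) : Matrix _ _ ℂ) j k = _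
    simp
  refine (Finset.sum_congr rfl fun k _ => Finset.sum_congr rfl fun j _ => h j k).trans ?_
  simp [Matrix.trace]

variable {A : Type*} [NonUnitalRing A] [Module ℂ A] [SMulCommClass ℂ A A]

theorem trace_mulLeft_of_matrix_equiv (e : A ≃ₗ[ℂ] Π i, Matrix (Fin (d i)) (Fin (d i)) ℂ)
    (he : ∀ a b, e (a * b) = e a * e b) (a : A) :
    LinearMap.trace ℂ A (LinearMap.mulLeft ℂ a) = ∑ i, (d i : ℂ) * (e a i).trace := by
  rw [← trace_mulLeft_pi_matrix, ← LinearMap.trace_conj' _ e]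
  congr 1
  ext1 x
  simp [LinearEquiv.conj_apply, he]

end MatrixProducts

/-! ### Semisimplicity from the trace form. -/

section Semisimple

/-- A finite-dimensional algebra whose trace form is nondegenerate is semisimple. -/
theorem isSemisimpleRing_of_trace_nondegenerate {A : Type*} [Ring A] [Algebra ℂ A]
    [FiniteDimensional ℂ A]
    (h : ∀ a : A, (∀ b, LinearMap.trace ℂ A (LinearMap.mulLeft ℂ (a * b)) = 0) → a = 0) :
    IsSemisimpleRing A := by
  have : IsArtinianRing A := IsArtinianRing.of_finite ℂ A
  rw [IsArtinianRing.isSemisimpleRing_iff_jacobson, eq_bot_iff]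
  intro a ha
  refine h a fun b => ?_
  have hab : a * b ∈ Ring.jacobson A := Ideal.mul_mem_right b _ ha
  obtain ⟨n, hn⟩ := IsArtinianRing.isNilpotent_jacobson_bot (R := A)
  have hnil : IsNilpotent (a * b) := by
    refine ⟨n, ?_⟩
    have := Ideal.pow_mem_pow hab n
    rw [Ideal.jacobson_bot] at hn
    simpa [hn] using this
  have h2 : IsNilpotent (LinearMap.mulLeft ℂ (a * b)) := by
    obtain ⟨m, hm⟩ := hnil
    exact ⟨m, by rw [LinearMap.pow_mulLeft, hm, LinearMap.mulLeft_zero_eq_zero]⟩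
  exact (LinearMap.isNilpotent_trace_of_isNilpotent h2).eq_zero

/-- The Wedderburn decomposition of an algebra with a right unit and nondegenerate trace form. -/
theorem exists_matrix_equiv_of_trace_nondegenerate {A : Type*} [NonUnitalRing A] [Module ℂ A]
    [IsScalarTower ℂ A A] [SMulCommClass ℂ A A] [FiniteDimensional ℂ A]
    (h : ∀ a : A, (∀ b, LinearMap.trace ℂ A (LinearMap.mulLeft ℂ (a * b)) = 0) → a = 0)
    (u : A) (hu : ∀ a, a * u = a) :
    ∃ (n : ℕ) (d : Fin n → ℕ) (e : A ≃ₗ[ℂ] Π i, Matrix (Fin (d i)) (Fin (d i)) ℂ),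
      (∀ i, NeZero (d i)) ∧ ∀ a b, e (a * b) = e a * e b := by
  -- The right unit is two-sided: by cyclicity, `u * a - a` pairs with `b` as `b * (u * a - a) = 0`
  -- does.
  have hu' : ∀ a, u * a = a := fun a => by
    rw [← sub_eq_zero]
    refine h _ fun b => ?_
    have hmul : ∀ x y : A, LinearMap.mulLeft ℂ (x * y) =
        LinearMap.mulLeft ℂ x * LinearMap.mulLeft ℂ y := fun x y => by
      ext z; simp
    rw [hmul, LinearMap.trace_mul_comm, ← hmul, mul_sub, ← mul_assoc, hu, sub_self]
    simp
  let : Ring A := { ‹NonUnitalRing A› with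
    one := u
    one_mul := hu'
    mul_one := hu }
  let : Algebra ℂ A := Algebra.ofModule smul_mul_assoc mul_smul_comm
  have := isSemisimpleRing_of_trace_nondegenerate h
  obtain ⟨n, d, hd, ⟨e⟩⟩ := IsSemisimpleRing.exists_algEquiv_pi_matrix_of_isAlgClosed ℂ A
  exact ⟨n, d, e.toLinearEquiv, hd, fun a b => map_mul e a b⟩

end Semisimple

/-! ### Irreducible representations and matrix blocks. -/

namespace MatRep

variable {S : Type*} [Semigroup S]

theorem Equivalent.symm {ρ σ : MatRep S} (h : Equivalent ρ σ) : Equivalent σ ρ := by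
  obtain ⟨A, B, hAB, hBA, h⟩ := h
  refine ⟨B, A, hBA, hAB, fun a => ?_⟩
  rw [h, ← Matrix.mul_assoc, ← Matrix.mul_assoc, hBA, Matrix.one_mul, Matrix.mul_assoc, hBA,
    Matrix.mul_one]

theorem Equivalent.trans {ρ σ τ : MatRep S} (h : Equivalent ρ σ) (h' : Equivalent σ τ) :
    Equivalent ρ τ := by
  obtain ⟨A, B, hAB, hBA, h⟩ := h
  obtain ⟨A', B', hAB', hBA', h'⟩ := h'
  refine ⟨A' * A, B * B', ?_, ?_, fun a => ?_⟩
  · rw [Matrix.mul_assoc, ← Matrix.mul_assoc A, hAB, Matrix.one_mul, hAB']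
  · rw [Matrix.mul_assoc, ← Matrix.mul_assoc B', hBA', Matrix.one_mul, hBA]
  · rw [h', h]
    simp only [Matrix.mul_assoc]

theorem Equivalent.trace_eq {ρ σ : MatRep S} (h : Equivalent ρ σ) (a : MonoidAlgebra ℂ S) :
    (σ.hom a).trace = (ρ.hom a).trace := by
  obtain ⟨A, B, -, hBA, h⟩ := h
  rw [h, Matrix.mul_assoc, Matrix.trace_mul_comm, Matrix.mul_assoc, hBA, Matrix.mul_one]

theorem Equivalent.dim_eq {ρ σ : MatRep S} (h : Equivalent ρ σ) : (σ.dim : ℂ) = ρ.dim := by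
  obtain ⟨A, B, hAB, hBA, -⟩ := h
  simpa [hAB, hBA] using Matrix.trace_mul_comm A B

section Components

variable {n : ℕ} {d : Fin n → ℕ}
  (e : MonoidAlgebra ℂ S ≃ₗ[ℂ] Π i, Matrix (Fin (d i)) (Fin (d i)) ℂ)

/-- The representation given by projection to a matrix block. -/
noncomputable def component (he : ∀ a b, e (a * b) = e a * e b) (i : Fin n) : MatRep S where
  dim := d i
  hom :=
    { toFun := fun a => e a i
      map_smul' := fun c a => by simp
      map_zero' := by simp
      map_add' := fun a b => by simp
      map_mul' := fun a b => by simp [he] }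

theorem component_hom (he : ∀ a b, e (a * b) = e a * e b) (i : Fin n) (a : MonoidAlgebra ℂ S) :
    (component e he i).hom a = e a i :=
  rfl

theorem symm_mul (he : ∀ a b, e (a * b) = e a * e b)
    (x y : Π i, Matrix (Fin (d i)) (Fin (d i)) ℂ) :
    e.symm (x * y) = e.symm x * e.symm y := by
  apply e.injective
  simp [he]

theorem component_irreducible (he : ∀ a b, e (a * b) = e a * e b) (i : Fin n)
    [NeZero (d i)] : Irreducible (component e he i) := by
  classical
  constructor
  · intro h
    have h1 : (component e he i).hom (e.symm (Pi.single i 1)) = 0 := by rw [h]; rfl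
    rw [component_hom, LinearEquiv.apply_symm_apply, Pi.single_eq_same] at h1
    exact one_ne_zero (congrFun (congrFun h1 0) 0)
  · intro W hW
    refine or_iff_not_imp_left.mpr fun hne => ?_
    obtain ⟨w, hw, hw0⟩ := W.ne_bot_iff.mp hne
    obtain ⟨k, hk⟩ := Function.ne_iff.mp hw0
    rw [eq_top_iff]
    rintro x -
    -- This rank-one matrix sends `w` to the arbitrary vector `x`.
    have h1 := hW (e.symm (Pi.single i
      (Matrix.vecMulVec x (Pi.single k (w k)⁻¹)))) w hw
    rw [component_hom, LinearEquiv.apply_symm_apply, Pi.single_eq_same] at h1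
    have h2 : (Matrix.vecMulVec x (Pi.single k (w k)⁻¹)).mulVec w = x := by
      have : (w k)⁻¹ * w k = 1 := inv_mul_cancel₀ hk
      ext l
      simp [Matrix.vecMulVec_mulVec, this]
    exact h2 ▸ h1

theorem component_inequivalent (he : ∀ a b, e (a * b) = e a * e b) [∀ i, NeZero (d i)]
    {i j : Fin n}
    (h : Equivalent (component e he i) (component e he j)) : i = j := by
  classical
  by_contra hij
  -- The unit of block `i` has trace `d i` in component `i` and 0 in component `j`.
  have h1 := h.trace_eq (e.symm (Pi.single i 1))
  rw [component_hom, component_hom, LinearEquiv.apply_symm_apply, Pi.single_eq_same,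
    Pi.single_eq_of_ne (Ne.symm hij)] at h1
  have h2 : (d i : ℂ) = 0 :=
    (Matrix.trace_one.trans (congrArg Nat.cast (Fintype.card_fin _))).symm.trans
      (h1.symm.trans (Matrix.trace_zero _ _))
  exact NeZero.ne (d i) (by exact_mod_cast h2)

/-- Some diagonal matrix unit E_jj of a block `i` moves a vector `w` to a nonzero one. Then x ↦ σ(x
e_jᵀ) w intertwines the column space of block `i` with `σ`. It is injective because E_jk recovers
the coordinate x_k, and surjective because its range is a nonzero invariant subspace. -/
theorem exists_component_equivalent (he : ∀ a b, e (a * b) = e a * e b) {σ : MatRep S}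
    (hσ : Irreducible σ) : ∃ i, Equivalent (component e he i) σ := by
  classical
  obtain ⟨i, j, hij⟩ : ∃ i, ∃ j : Fin (d i),
      σ.hom (e.symm (Pi.single i (Matrix.single j j 1))) ≠ 0 := by
    by_contra! h
    apply hσ.1
    refine NonUnitalAlgHom.ext fun a => ?_
    have ha : e a = ∑ i, ∑ j : Fin (d i),
        Pi.single i (e a i) * Pi.single i (Matrix.single j j (1 : ℂ)) := by
      simp_rw [← Pi.single_mul]
      ext1 k
      rw [Finset.sum_apply, Finset.sum_eq_single k]
      · rw [Finset.sum_apply]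
        simp only [Pi.single_eq_same, ← Finset.mul_sum, Matrix.sum_single_one, mul_one]
      · intro b _ hb
        rw [Finset.sum_apply]
        simp [Pi.single_eq_of_ne hb.symm]
      · simp
    rw [← e.symm_apply_apply a, ha, map_sum, map_sum]
    refine Finset.sum_eq_zero fun i _ => ?_
    rw [map_sum, map_sum]
    refine Finset.sum_eq_zero fun j _ => ?_
    rw [symm_mul e he, map_mul, h, mul_zero]
  obtain ⟨w, hw⟩ : ∃ w, (σ.hom (e.symm (Pi.single i (Matrix.single j j 1)))).mulVec w ≠ 0 := by
    by_contra! h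
    exact hij (Matrix.ext_of_mulVec_single fun k => by rw [h, Matrix.zero_mulVec])
  let T : (Fin (d i) → ℂ) →ₗ[ℂ] (Fin σ.dim → ℂ) :=
    { toFun := fun x =>
        (σ.hom (e.symm (Pi.single i (Matrix.vecMulVec x (Pi.single j 1))))).mulVec w
      map_add' := fun x y => by
        rw [Matrix.add_vecMulVec, Pi.single_add, map_add, map_add, Matrix.add_mulVec]
      map_smul' := fun c x => by
        rw [Matrix.smul_vecMulVec, Pi.single_smul, map_smul, map_smul, Matrix.smul_mulVec,
          RingHom.id_apply] }
  have hT : ∀ x, T x =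
    (σ.hom (e.symm (Pi.single i (Matrix.vecMulVec x (Pi.single j 1))))).mulVec w := fun _ => rfl
  have hcomm : ∀ a x, (σ.hom a).mulVec (T x) = T ((e a i).mulVec x) := by
    intro a x
    rw [hT, hT, Matrix.mulVec_mulVec, ← map_mul, ← Matrix.mul_vecMulVec]
    congr 3
    apply e.injective
    rw [he, LinearEquiv.apply_symm_apply, LinearEquiv.apply_symm_apply]
    ext1 k
    obtain rfl | hk := eq_or_ne k i
    · simp
    · simp [Pi.single_eq_of_ne hk]
  have hTj : T (Pi.single j 1) ≠ 0 := by
    rw [hT, ← Matrix.single_eq_single_vecMulVec_single]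
    exact hw
  have hinj : Function.Injective T := by
    rw [injective_iff_map_eq_zero]
    intro x hx
    ext k
    have h1 := hcomm (e.symm (Pi.single i (Matrix.single j k 1))) x
    rw [hx, Matrix.mulVec_zero, LinearEquiv.apply_symm_apply, Pi.single_eq_same] at h1
    have h2 : (Matrix.single j k (1 : ℂ)).mulVec x = x k • Pi.single j (1 : ℂ) := by
      rw [Matrix.single_mulVec]
      ext l
      by_cases hl : l = j
      · subst hl; simp
      · simp [hl]
    rw [h2, map_smul, eq_comm, smul_eq_zero] at h1
    exact h1.resolve_right hTj
  have hsurj : Function.Surjective T := by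
    rw [← LinearMap.range_eq_top]
    refine (hσ.2 (LinearMap.range T) ?_).resolve_left ?_
    · rintro a _ ⟨x, rfl⟩
      exact ⟨_, (hcomm a x).symm⟩
    · intro h
      exact hTj ((LinearMap.range_eq_bot.mp h) ▸ rfl)
  let T' := LinearEquiv.ofBijective T ⟨hinj, hsurj⟩
  have h1 : T ∘ₗ T'.symm.toLinearMap = LinearMap.id := by
    exact LinearMap.ext fun x => T'.apply_symm_apply x
  have h2 : T'.symm.toLinearMap ∘ₗ T = LinearMap.id := by
    exact LinearMap.ext fun x => T'.symm_apply_apply x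
  have h1' : LinearMap.toMatrix' T * LinearMap.toMatrix' T'.symm.toLinearMap = 1 := by
    rw [← LinearMap.toMatrix'_comp, h1, LinearMap.toMatrix'_id]
  have h2' : LinearMap.toMatrix' T'.symm.toLinearMap * LinearMap.toMatrix' T = 1 := by
    rw [← LinearMap.toMatrix'_comp, h2, LinearMap.toMatrix'_id]
  refine ⟨i, LinearMap.toMatrix' T, LinearMap.toMatrix' T'.symm.toLinearMap, h1', h2', fun a => ?_⟩
  have h3 : σ.hom a * LinearMap.toMatrix' T = LinearMap.toMatrix' T * e a i := by
    apply Matrix.ext_of_mulVec_single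
    intro k
    rw [← Matrix.mulVec_mulVec, ← Matrix.mulVec_mulVec, LinearMap.toMatrix'_mulVec,
      LinearMap.toMatrix'_mulVec, hcomm]
  have h4 : σ.hom a =
      LinearMap.toMatrix' T * e a i * LinearMap.toMatrix' T'.symm.toLinearMap := by
    rw [← h3, Matrix.mul_assoc, h1', Matrix.mul_one]
  exact h4

theorem IsCompleteSet.exists_finite_sum_trace (he : ∀ a b, e (a * b) = e a * e b)
    [∀ i, NeZero (d i)] {X : Set (MatRep S)} (hX : IsCompleteSet X) :
    ∃ hfin : X.Finite, ∀ a : MonoidAlgebra ℂ S,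
      ∑ ρ ∈ hfin.toFinset, (ρ.dim : ℂ) * (ρ.hom a).trace = ∑ i, (d i : ℂ) * (e a i).trace := by
  choose r hrX hr using fun i => hX.complete _ (component_irreducible e he i)
  have hinj : Function.Injective r := fun i j hij =>
    component_inequivalent e he ((hr i).trans (hij ▸ (hr j).symm))
  have hrange : X = Set.range r := by
    ext ρ
    constructor
    · intro hρ
      obtain ⟨i, hi⟩ := exists_component_equivalent e he (hX.irreducible ρ hρ)
      exact ⟨i, hX.inequivalent _ (hrX i) _ hρ ((hr i).symm.trans hi)⟩
    · rintro ⟨i, rfl⟩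
      exact hrX i
  have hfin : X.Finite := hrange ▸ Set.finite_range r
  refine ⟨hfin, fun a => ?_⟩
  have himage : hfin.toFinset = Finset.univ.map ⟨r, hinj⟩ := by
    ext ρ
    simp [hrange]
  rw [himage, Finset.sum_map]
  refine Finset.sum_congr rfl fun i _ => ?_
  change ((r i).dim : ℂ) * ((r i).hom a).trace = _
  rw [(hr i).dim_eq, (hr i).trace_eq]
  rfl

end Components

end MatRep

/-! ### Inverses, idempotents and the natural order. -/

section OrderLemmas

variable {S : Type*} [Semigroup S] [IsInverseSemigroup S]

theorem sinv_sinv (x : S) : sinv (sinv x) = x :=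
  (eq_sinv (sinv_mul_sinv x) (mul_sinv_mul x)).symm

theorem sinv_of_idem {e : S} (he : IsIdempotentElem e) : sinv e = e :=
  (eq_sinv (by rw [he.eq, he.eq]) (by rw [he.eq, he.eq])).symm

theorem idem_dom (x : S) : IsIdempotentElem (dom x) := by
  change sinv x * x * (sinv x * x) = sinv x * x
  rw [← mul_assoc, sinv_mul_sinv]

theorem idem_ran (x : S) : IsIdempotentElem (ran x) := by
  change x * sinv x * (x * sinv x) = x * sinv x
  rw [← mul_assoc, mul_sinv_mul]

theorem ran_mul_self (x : S) : ran x * x = x := mul_sinv_mul x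

theorem mul_dom_self (x : S) : x * dom x = x := (mul_assoc _ _ _).symm.trans (mul_sinv_mul x)

theorem dom_mul_sinv (x : S) : dom x * sinv x = sinv x := sinv_mul_sinv x

theorem sinv_mul_ran (x : S) : sinv x * ran x = sinv x :=
  (mul_assoc _ _ _).symm.trans (sinv_mul_sinv x)

theorem dom_sinv (x : S) : dom (sinv x) = ran x := by rw [dom, sinv_sinv, ran]

theorem ran_sinv (x : S) : ran (sinv x) = dom x := by rw [ran, sinv_sinv, dom]

theorem dom_of_idem {e : S} (he : IsIdempotentElem e) : dom e = e := by
  rw [dom, sinv_of_idem he, he.eq]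

theorem ran_of_idem {e : S} (he : IsIdempotentElem e) : ran e = e := by
  rw [ran, sinv_of_idem he, he.eq]

theorem sinv_mul (s t : S) : sinv (s * t) = sinv t * sinv s := by
  refine (eq_sinv ?_ ?_).symm
  · calc s * t * (sinv t * sinv s) * (s * t) = s * (ran t * dom s) * t := by
          simp only [ran, dom, mul_assoc]
      _ = s * dom s * (ran t * t) := by
          rw [idem_comm (idem_ran t) (idem_dom s)]; simp only [mul_assoc]
      _ = s * t := by rw [mul_dom_self, ran_mul_self]
  · calc sinv t * sinv s * (s * t) * (sinv t * sinv s)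
          = sinv t * (dom s * ran t) * sinv s := by simp only [ran, dom, mul_assoc]
      _ = sinv t * ran t * (dom s * sinv s) := by
          rw [idem_comm (idem_dom s) (idem_ran t)]; simp only [mul_assoc]
      _ = sinv t * sinv s := by rw [sinv_mul_ran, dom_mul_sinv]

theorem ran_mul (s t : S) : ran (s * t) = s * ran t * sinv s := by
  rw [ran, sinv_mul, ran]
  simp only [mul_assoc]

theorem dom_mul (s t : S) : dom (s * t) = sinv t * dom s * t := by
  rw [dom, sinv_mul, dom]
  simp only [mul_assoc]

/-- Commuting `f` past s⁻¹s turns it into a conjugate idempotent on the left, which makes the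
natural order left-right symmetric. -/
theorem mul_idem_eq (s : S) {f : S} (hf : IsIdempotentElem f) :
    s * f = s * f * sinv s * s := by
  calc s * f = s * dom s * f := by rw [mul_dom_self]
    _ = s * (dom s * f) := mul_assoc _ _ _
    _ = s * f * sinv s * s := by
      rw [idem_comm (idem_dom s) hf, dom]; simp only [mul_assoc]

theorem idem_conj (s : S) {f : S} (hf : IsIdempotentElem f) : IsIdempotentElem (s * f * sinv s) := by
  have h := idem_ran (s * f)
  rwa [ran_mul, ran_of_idem hf] at h

theorem natLE_of_eq_mul_idem {s t f : S} (hf : IsIdempotentElem f) (h : s = t * f) : NatLE s t :=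
  ⟨t * f * sinv t, idem_conj t hf, h.trans (mul_idem_eq t hf)⟩

theorem NatLE.sinv {s t : S} (h : NatLE s t) : NatLE (sinv s) (sinv t) := by
  obtain ⟨e, he, rfl⟩ := h
  exact natLE_of_eq_mul_idem he (by rw [sinv_mul, sinv_of_idem he])

theorem NatLE.eq_ran_mul {s t : S} (h : NatLE s t) : s = ran s * t := by
  obtain ⟨e, he, rfl⟩ := h
  calc e * t = e * ran t * t := by rw [mul_assoc, ran_mul_self]
    _ = e * e * ran t * t := by rw [he.eq]
    _ = e * (ran t * e) * t := by rw [mul_assoc e e, idem_comm he (idem_ran t)]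
    _ = ran (e * t) * t := by rw [ran_mul, sinv_of_idem he, mul_assoc e (ran t)]

theorem NatLE.eq_mul_dom {s t : S} (h : NatLE s t) : s = t * dom s := by
  have h1 := h.sinv.eq_ran_mul
  have h2 := congrArg InverseSemigroup.sinv h1
  rwa [sinv_mul, sinv_sinv, sinv_sinv, ran_sinv, sinv_of_idem (idem_dom s)] at h2

theorem NatLE.idem {s e : S} (h : NatLE s e) (he : IsIdempotentElem e) : IsIdempotentElem s := by
  obtain ⟨f, hf, rfl⟩ := h
  exact idem_mul_idem hf he

theorem NatLE.mul_left {v u : S} (h : NatLE v u) (s : S) : NatLE (s * v) (s * u) :=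
  natLE_of_eq_mul_idem (idem_dom v) (by rw [mul_assoc, ← h.eq_mul_dom])

theorem mul_eq_self_iff (s u : S) : s * u = u ↔ NatLE (ran u) s := by
  constructor
  · intro h
    exact natLE_of_eq_mul_idem (idem_ran u) (by rw [ran, ← mul_assoc, h])
  · intro h
    have h1 := h.eq_mul_dom
    rw [dom_of_idem (idem_ran u)] at h1
    rw [← ran_mul_self u, ← mul_assoc, ← h1]

theorem dom_mul_of_mul_eq_self {s u : S} (h : s * u = u) : dom s * u = u := by
  have h1 := ((mul_eq_self_iff s u).mp h).sinv
  rw [sinv_of_idem (idem_ran u)] at h1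
  rw [dom, mul_assoc, h]
  exact (mul_eq_self_iff _ _).mpr h1

/-- The right side is what makes s⌊t⁻¹⌋ nonzero and of nonzero regular trace. -/
theorem natLE_iff_mul_sinv (s t : S) :
    NatLE t s ↔ dom s * sinv t = sinv t ∧ IsIdempotentElem (s * sinv t) := by
  constructor
  · intro h
    have h1 : sinv t = sinv s * ran t := by
      have h2 := h.sinv.eq_mul_dom
      rwa [dom_sinv] at h2
    refine ⟨?_, ?_⟩
    · rw [h1, ← mul_assoc, dom_mul_sinv]
    · rw [h1, ← mul_assoc]
      exact idem_mul_idem (idem_ran s) (idem_ran t)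
  · rintro ⟨h1, h2⟩
    refine ⟨s * sinv t, h2, ?_⟩
    have h3 := congrArg sinv h1
    rw [dom, mul_assoc, sinv_mul, sinv_sinv, sinv_sinv, sinv_of_idem h2] at h3
    exact h3.symm

theorem mul_sinv_of_natLE {s t : S} (h : NatLE t s) : s * sinv t = ran t := by
  have h2 := h.sinv.eq_mul_dom
  rw [dom_sinv] at h2
  have h3 : NatLE (ran t) (ran s) := by
    refine natLE_of_eq_mul_idem (idem_ran t) ?_
    have h4 := h.eq_mul_dom
    have h5 : ran s * t = t := by
      conv_rhs => rw [h4]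
      conv_lhs => rw [h4]
      rw [← mul_assoc, ran_mul_self]
    calc ran t = ran s * t * sinv t := by rw [h5]; rfl
      _ = ran s * ran t := mul_assoc _ _ _
  rw [h2, ← mul_assoc]
  have h6 := h3.eq_mul_dom
  rw [dom_of_idem (idem_ran t)] at h6
  exact h6.symm

variable [Fintype S]

/-- Left multiplication by `s` is a bijection between the two index sets, with inverse left
multiplication by s⁻¹. This is the product rule for the Möbius basis in combinatorial form. -/
theorem sum_mul_left {M : Type*} [AddCommMonoid M] (s u : S) (g : S → M) :
    ∑ v : S with NatLE v u, (open Classical in if dom s * v = v then g (s * v) else 0) =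
      ∑ c : S with NatLE c (s * u), g c := by
  classical
  rw [← Finset.sum_filter, Finset.filter_filter]
  refine Finset.sum_nbij' (fun v => s * v) (fun c => sinv s * c) ?_ ?_ ?_ ?_ ?_
  · intro v hv
    simp only [Finset.mem_filter, Finset.mem_univ, true_and] at hv ⊢
    exact hv.1.mul_left s
  · intro c hc
    simp only [Finset.mem_filter, Finset.mem_univ, true_and] at hc ⊢
    refine ⟨?_, by rw [← mul_assoc, dom_mul_sinv]⟩
    obtain ⟨e, he, rfl⟩ := hc
    refine ⟨sinv s * e * s, ?_, by simp only [mul_assoc]⟩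
    have := idem_conj (sinv s) he
    rwa [sinv_sinv] at this
  · intro v hv
    simp only [Finset.mem_filter, Finset.mem_univ, true_and] at hv
    rw [← mul_assoc]
    exact hv.2
  · intro c hc
    simp only [Finset.mem_filter, Finset.mem_univ, true_and] at hc
    have h : c = s * (u * dom c) := by rw [← mul_assoc]; exact hc.eq_mul_dom
    change s * (sinv s * c) = c
    rw [← mul_assoc, h, ← mul_assoc, mul_sinv_mul]
  · intro v _
    rfl

end OrderLemmas

/-! ### Möbius inversion and the Möbius basis. -/

section Moebius

variable {S : Type*} [Semigroup S] [IsInverseSemigroup S] [Fintype S]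

open Classical in
theorem sum_moebius_left (s t : S) :
    ∑ x : S with NatLE s x ∧ NatLE x t, moebius s x = if s = t then 1 else 0 := by
  let : PartialOrder S := naturalOrder S
  let : DecidableLE S := Classical.decRel _
  let : DecidableLT S := Classical.decRel _
  let : LocallyFiniteOrder S := Fintype.toLocallyFiniteOrder
  rw [← IncidenceAlgebra.sum_Icc_mu_right (𝕜 := ℂ) s t]
  refine Finset.sum_congr ?_ fun _ _ => rfl
  ext x
  rw [Finset.mem_Icc, Finset.mem_filter]
  exact and_iff_right (Finset.mem_univ x)

open Classical in
theorem sum_moebius_right (s t : S) :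
    ∑ x : S with NatLE s x ∧ NatLE x t, moebius x t = if s = t then 1 else 0 := by
  let : PartialOrder S := naturalOrder S
  let : DecidableLE S := Classical.decRel _
  let : DecidableLT S := Classical.decRel _
  let : LocallyFiniteOrder S := Fintype.toLocallyFiniteOrder
  rw [← IncidenceAlgebra.sum_Icc_mu_left (𝕜 := ℂ) s t]
  refine Finset.sum_congr ?_ fun _ _ => rfl
  ext x
  rw [Finset.mem_Icc, Finset.mem_filter]
  exact and_iff_right (Finset.mem_univ x)

/-- The sum of the coefficients over the elements above a given one. -/
noncomputable def upperSum (S : Type*) [Semigroup S] [IsInverseSemigroup S] [Fintype S] :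
    MonoidAlgebra ℂ S →ₗ[ℂ] (S → ℂ) where
  toFun a t := ∑ s : S with NatLE t s, a.coeff s
  map_add' a b := by
    ext t
    simp [Finset.sum_add_distrib]
  map_smul' c a := by
    ext t
    simp [Finset.mul_sum]

theorem upperSum_apply (a : MonoidAlgebra ℂ S) (t : S) :
    upperSum S a t = ∑ s : S with NatLE t s, a.coeff s := rfl

theorem upperSum_single (s t : S) (c : ℂ) :
    upperSum S (MonoidAlgebra.single s c) t = if NatLE t s then c else 0 := by
  classical
  simp [upperSum_apply, Finsupp.single_apply, Finset.sum_ite_eq]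

theorem coeff_eq_sum_moebius (a : MonoidAlgebra ℂ S) (s : S) :
    a.coeff s = ∑ t : S with NatLE s t, moebius s t * upperSum S a t := by
  classical
  have h : ∀ v, (∑ t : S with NatLE s t ∧ NatLE t v, moebius s t) * a.coeff v =
      ∑ t : S, if NatLE s t then (if NatLE t v then moebius s t * a.coeff v else 0) else 0 := by
    intro v
    simp_rw [Finset.sum_mul, Finset.sum_filter, ite_and]
  calc a.coeff s = ∑ v : S, (if s = v then 1 else 0) * a.coeff v := by simp
    _ = ∑ v : S, ∑ t : S,
        if NatLE s t then (if NatLE t v then moebius s t * a.coeff v else 0) else 0 :=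
      Finset.sum_congr rfl fun v _ => by rw [← h, sum_moebius_left]
    _ = _ := by
      rw [Finset.sum_comm, Finset.sum_filter]
      refine Finset.sum_congr rfl fun t _ => ?_
      rw [upperSum_apply, Finset.sum_filter, Finset.mul_sum]
      split_ifs with hst
      · exact Finset.sum_congr rfl fun v _ => by split_ifs <;> simp
      · simp

/-- The Möbius transform of an element of `S`, in the semigroup algebra. -/
noncomputable def moebiusElem (u : S) : MonoidAlgebra ℂ S :=
  ∑ v : S with NatLE v u, MonoidAlgebra.single v (moebius v u)

open Classical in
theorem upperSum_moebiusElem (u : S) : upperSum S (moebiusElem u) = Pi.single u 1 := by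
  ext t
  rw [moebiusElem, map_sum, Finset.sum_apply, Pi.single_apply, ← sum_moebius_right,
    Finset.sum_filter, Finset.sum_filter]
  refine Finset.sum_congr rfl fun v _ => ?_
  rw [upperSum_single]
  by_cases h1 : NatLE v u <;> by_cases h2 : NatLE t v <;> simp [h1, h2]

theorem upperSum_bijective : Function.Bijective (upperSum S) := by
  classical
  constructor
  · intro a b h
    ext s
    rw [coeff_eq_sum_moebius, coeff_eq_sum_moebius, h]
  · intro g
    refine ⟨∑ u, g u • moebiusElem u, ?_⟩
    simp_rw [map_sum, map_smul, upperSum_moebiusElem]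
    ext t
    simp [Pi.single_apply]

/-- The basis of the semigroup algebra given by the Möbius transforms of the elements. -/
noncomputable def moebiusBasis (S : Type*) [Semigroup S] [IsInverseSemigroup S] [Fintype S] :
    Module.Basis S ℂ (MonoidAlgebra ℂ S) :=
  Module.Basis.ofEquivFun (LinearEquiv.ofBijective (upperSum S) upperSum_bijective)

theorem moebiusBasis_repr (a : MonoidAlgebra ℂ S) (t : S) :
    (moebiusBasis S).repr a t = upperSum S a t := rfl

theorem moebiusBasis_apply (u : S) : moebiusBasis S u = moebiusElem u := by
  classical
  apply upperSum_bijective.1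
  rw [upperSum_moebiusElem]
  ext t
  rw [← moebiusBasis_repr, Module.Basis.repr_self, Finsupp.single_apply, Pi.single_apply]
  simp only [eq_comm]

theorem single_eq_sum_moebiusBasis (s : S) :
    MonoidAlgebra.single s (1 : ℂ) = ∑ v : S with NatLE v s, moebiusBasis S v := by
  rw [← (moebiusBasis S).sum_repr (MonoidAlgebra.single s 1), Finset.sum_filter]
  refine Finset.sum_congr rfl fun v _ => ?_
  rw [moebiusBasis_repr, upperSum_single]
  split_ifs <;> simp

end Moebius

/-! ### The trace of the left regular representation. -/

section RegularTrace

theorem linearMap_ext {S : Type*} {M : Type*} [AddCommMonoid M] [Module ℂ M]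
    {L L' : MonoidAlgebra ℂ S →ₗ[ℂ] M}
    (h : ∀ s, L (MonoidAlgebra.single s 1) = L' (MonoidAlgebra.single s 1)) : L = L' :=
  MonoidAlgebra.lhom_ext' fun s => LinearMap.ext_ring (h s)

/-- The trace of the left regular representation. -/
noncomputable def regularTrace (S : Type*) [Semigroup S] :
    MonoidAlgebra ℂ S →ₗ[ℂ] ℂ :=
  LinearMap.trace ℂ (MonoidAlgebra ℂ S) ∘ₗ LinearMap.mul ℂ (MonoidAlgebra ℂ S)

theorem regularTrace_apply {S : Type*} [Semigroup S] (a : MonoidAlgebra ℂ S) :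
    regularTrace S a = LinearMap.trace ℂ _ (LinearMap.mulLeft ℂ a) := rfl

variable {S : Type*} [Semigroup S] [IsInverseSemigroup S] [Fintype S]

-- By linearity it suffices to test the rule on each element of `S`, expanded as the sum of the
-- basis vectors below it; `sum_mul_left` matches the two expansions.
open Classical in
theorem single_mul_moebiusBasis (s u : S) :
    MonoidAlgebra.single s (1 : ℂ) * moebiusBasis S u =
      if dom s * u = u then moebiusBasis S (s * u) else 0 := by
  have h : LinearMap.mulLeft ℂ (MonoidAlgebra.single s (1 : ℂ)) =
      (moebiusBasis S).constr ℂ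
        (fun u => if dom s * u = u then moebiusBasis S (s * u) else 0) := by
    refine linearMap_ext fun u => ?_
    change MonoidAlgebra.single s (1 : ℂ) * MonoidAlgebra.single u 1 =
      (moebiusBasis S).constr ℂ _ (MonoidAlgebra.single u 1)
    rw [MonoidAlgebra.single_mul_single, mul_one, single_eq_sum_moebiusBasis,
      single_eq_sum_moebiusBasis, map_sum, ← sum_mul_left s u]
    exact Finset.sum_congr rfl fun v _ => by rw [Module.Basis.constr_basis]
  have h1 := LinearMap.congr_fun h (moebiusBasis S u)
  rwa [Module.Basis.constr_basis] at h1

-- In the Möbius basis `s` acts by a partial injection, so its trace counts fixed points.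
open Classical in
theorem regularTrace_single (s : S) :
    regularTrace S (MonoidAlgebra.single s 1) = ∑ u : S, if s * u = u then 1 else 0 := by
  rw [regularTrace_apply, LinearMap.trace_eq_matrix_trace ℂ (moebiusBasis S), Matrix.trace]
  refine Finset.sum_congr rfl fun u _ => ?_
  rw [Matrix.diag_apply, LinearMap.toMatrix_apply, LinearMap.mulLeft_apply,
    single_mul_moebiusBasis]
  by_cases h : s * u = u
  · simp [dom_mul_of_mul_eq_self h, h]
  · by_cases h' : dom s * u = u <;> simp [h, h']

-- The fixed points of `s` are the `u` with `ran u` ≤ `s`; sorting them by `c = ran u` matches the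
-- expansion of `s` in the basis. Only idempotent `c` occur.
open Classical in
theorem regularTrace_moebiusBasis (c : S) :
    regularTrace S (moebiusBasis S c) =
      if IsIdempotentElem c then ∑ u : S, if ran u = c then 1 else 0 else 0 := by
  have h : regularTrace S = (moebiusBasis S).constr ℂ
      (fun c => if IsIdempotentElem c then ∑ u : S, if ran u = c then (1 : ℂ) else 0 else 0) := by
    refine linearMap_ext fun s => ?_
    change regularTrace S (MonoidAlgebra.single s 1) =
      (moebiusBasis S).constr ℂ _ (MonoidAlgebra.single s 1)
    rw [regularTrace_single, single_eq_sum_moebiusBasis, map_sum]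
    simp_rw [Module.Basis.constr_basis]
    have h1 : ∀ c : S, (if IsIdempotentElem c then ∑ u : S, if ran u = c then (1 : ℂ) else 0
        else 0) = ∑ u : S, if ran u = c then (1 : ℂ) else 0 := by
      intro c
      split_ifs with hc
      · rfl
      · refine (Finset.sum_eq_zero fun u _ => if_neg ?_).symm
        rintro rfl
        exact hc (idem_ran u)
    simp_rw [h1]
    rw [Finset.sum_comm]
    refine Finset.sum_congr rfl fun u _ => ?_
    rw [Finset.sum_ite_eq]
    simp [mul_eq_self_iff]
  rw [h, Module.Basis.constr_basis]

open Classical in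
theorem regularTrace_mul_moebiusBasis_sinv (a : MonoidAlgebra ℂ S) (t : S) :
    regularTrace S (a * moebiusBasis S (sinv t)) =
      (∑ u : S, if ran u = ran t then 1 else 0) * upperSum S a t := by
  have h : regularTrace S ∘ₗ LinearMap.mulRight ℂ (moebiusBasis S (sinv t)) =
      (∑ u : S, if ran u = ran t then (1 : ℂ) else 0) • (LinearMap.proj t ∘ₗ upperSum S) := by
    refine linearMap_ext fun s => ?_
    rw [LinearMap.comp_apply, LinearMap.mulRight_apply, LinearMap.smul_apply,
      LinearMap.comp_apply, LinearMap.proj_apply, smul_eq_mul, single_mul_moebiusBasis,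
      upperSum_single]
    by_cases hts : NatLE t s
    · have h1 := (natLE_iff_mul_sinv s t).mp hts
      rw [if_pos hts, if_pos h1.1, regularTrace_moebiusBasis, if_pos h1.2,
        mul_sinv_of_natLE hts, mul_one]
    · rw [if_neg hts, mul_zero]
      split_ifs with h1
      · rw [regularTrace_moebiusBasis, if_neg]
        exact fun h2 => hts ((natLE_iff_mul_sinv s t).mpr ⟨h1, h2⟩)
      · exact map_zero _
  exact LinearMap.congr_fun h a

theorem exists_mul_eq_self : ∃ u : MonoidAlgebra ℂ S, ∀ a, a * u = a := by
  classical
  refine ⟨∑ f : S with IsIdempotentElem f, moebiusBasis S f, fun a => ?_⟩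
  have h : LinearMap.mulRight ℂ (∑ f : S with IsIdempotentElem f, moebiusBasis S f) =
      LinearMap.id := by
    refine linearMap_ext fun s => ?_
    change MonoidAlgebra.single s (1 : ℂ) * _ = MonoidAlgebra.single s 1
    -- Writing `s` as `s * dom s` parametrizes the elements below `s` by the idempotents below `dom
    -- s`, exactly those `f` with s⌊f⌋ ≠ 0.
    conv_rhs => rw [← mul_dom_self s, single_eq_sum_moebiusBasis, ← sum_mul_left]
    simp_rw [Finset.mul_sum, single_mul_moebiusBasis, Finset.sum_filter]
    refine Finset.sum_congr rfl fun v _ => ?_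
    by_cases h : dom s * v = v
    · have h1 : IsIdempotentElem v ↔ NatLE v (dom s) := by
        refine ⟨fun hv => natLE_of_eq_mul_idem hv h.symm, fun hv => hv.idem (idem_dom s)⟩
      simp [h, h1]
    · simp [h]
  exact LinearMap.congr_fun h a

theorem sum_ran_eq_ne_zero (t : S) :
    (∑ u : S, (open Classical in if ran u = ran t then (1 : ℂ) else 0)) ≠ 0 := by
  classical
  rw [Finset.sum_boole]
  exact_mod_cast Finset.card_ne_zero_of_mem (a := t) (by simp)

theorem eq_zero_of_regularTrace_mul_eq_zero (a : MonoidAlgebra ℂ S)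
    (h : ∀ b, regularTrace S (a * b) = 0) : a = 0 := by
  apply upperSum_bijective.1
  rw [map_zero]
  ext t
  have h1 := h (moebiusBasis S (sinv t))
  rw [regularTrace_mul_moebiusBasis_sinv] at h1
  exact (mul_eq_zero.mp h1).resolve_left (sum_ran_eq_ne_zero t)

theorem MatRep.IsCompleteSet.exists_finite_sum_trace_eq_regularTrace {X : Set (MatRep S)}
    (hX : MatRep.IsCompleteSet X) :
    ∃ hfin : X.Finite, ∀ a : MonoidAlgebra ℂ S,
      ∑ ρ ∈ hfin.toFinset, (ρ.dim : ℂ) * (ρ.hom a).trace = regularTrace S a := by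
  obtain ⟨u, hu⟩ := exists_mul_eq_self (S := S)
  have : FiniteDimensional ℂ (MonoidAlgebra ℂ S) := (moebiusBasis S).finiteDimensional_of_finite
  obtain ⟨n, d, e, hd, he⟩ := exists_matrix_equiv_of_trace_nondegenerate
    (A := MonoidAlgebra ℂ S) eq_zero_of_regularTrace_mul_eq_zero u hu
  obtain ⟨hfin, h⟩ := hX.exists_finite_sum_trace e he
  exact ⟨hfin, fun a => (h a).trans (trace_mulLeft_of_matrix_equiv e he a).symm⟩

end RegularTrace

/-! ### Counting elements with a given range. -/

section Counting

variable {S : Type*} [Semigroup S] [IsInverseSemigroup S]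

/-- The right side is a subgroup, and it contains every subgroup with identity `e`, since group
inverses are semigroup inverses. Maximality forces equality. -/
theorem IsMaximalSubgroupAt.eq_setOf {e : S} {G : Set S} (he : IsIdempotentElem e)
    (hG : IsMaximalSubgroupAt e G) : G = {u | ran u = e ∧ dom u = e} := by
  have h1 : IsSubgroupAt e {u : S | ran u = e ∧ dom u = e} :=
    { one_mem := ⟨ran_of_idem he, dom_of_idem he⟩
      mul_mem := by
        rintro g ⟨hg, hg'⟩ h ⟨hh, hh'⟩
        constructor
        · rw [ran_mul, hh, ← hg', mul_dom_self, hg', ← hg, ran]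
        · rw [dom_mul, hg', ← hh, sinv_mul_ran, hh, ← hh', dom]
      one_mul := by
        rintro g ⟨hg, -⟩
        rw [← hg, ran_mul_self]
      mul_one := by
        rintro g ⟨-, hg⟩
        rw [← hg, mul_dom_self]
      exists_inv := by
        rintro g ⟨hg, hg'⟩
        exact ⟨sinv g, ⟨by rw [ran_sinv, hg'], by rw [dom_sinv, hg]⟩, hg, hg'⟩ }
  refine hG.2.eq_of_le ⟨e, h1⟩ fun g hg => ?_
  obtain ⟨k, hk, hgk, hkg⟩ := hG.1.exists_inv g hg
  have h2 : k = sinv g := eq_sinv (by rw [hgk, hG.1.one_mul g hg])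
    (by rw [hkg, hG.1.one_mul k hk])
  subst h2
  exact ⟨hgk, hkg⟩

/-- Regard `u` as an arrow from `dom u` to `ran u`. Arrows `x` and `y` lead from `ran t` to `e` and
`f`, and u ↦ x u (y x⁻¹) carries arrows f → ran t to loops at `e`, invertibly. -/
theorem ncard_ran_dom_eq {t e f : S} (hte : DRel t e) (he : IsIdempotentElem e)
    (htf : DRel t f) (hf : IsIdempotentElem f) :
    {u : S | ran u = ran t ∧ dom u = f}.ncard = {u : S | ran u = e ∧ dom u = e}.ncard := by
  obtain ⟨x, hx, hx'⟩ := hte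
  obtain ⟨y, hy, hy'⟩ := htf
  rw [ran_of_idem he] at hx'
  rw [ran_of_idem hf] at hy'
  refine Set.ncard_congr (fun u _ => x * u * (y * sinv x)) ?_ ?_ ?_
  · rintro u ⟨hu, hu'⟩
    have h1 : ran (y * sinv x) = f := by
      rw [ran_mul, ran_sinv, hx, ← hy, mul_dom_self, ← hy', ran]
    have h2 : dom (y * sinv x) = e := by
      rw [dom_mul, sinv_sinv, hy, ← hx, mul_dom_self, ← hx', ran]
    have h3 : ran (x * u) = e := by
      rw [ran_mul, hu, ← hx, mul_dom_self, ← hx', ran]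
    have h4 : dom (x * u) = f := by
      rw [dom_mul, hx, ← hu, sinv_mul_ran, ← hu', dom]
    constructor
    · rw [ran_mul, h1, ← h4, mul_dom_self, ← h3, ran]
    · rw [dom_mul, h4, ← h1, sinv_mul_ran, ← h2, dom]
  · rintro u v ⟨hu, hu'⟩ ⟨hv, hv'⟩ h
    have h1 : ∀ w : S, ran w = ran t → dom w = f →
        sinv x * (x * w * (y * sinv x)) * (x * sinv y) = w := by
      intro w hw hw'
      calc sinv x * (x * w * (y * sinv x)) * (x * sinv y)
          = dom x * w * (y * dom x * sinv y) := by simp only [dom, mul_assoc]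
        _ = w * (y * sinv y) := by rw [hx, ← hw, ran_mul_self, hw, ← hy, mul_dom_self]
        _ = w := by
          change w * ran y = w
          rw [hy', ← hw', mul_dom_self]
    rw [← h1 u hu hu', ← h1 v hv hv', h]
  · rintro w ⟨hw, hw'⟩
    refine ⟨sinv x * w * (x * sinv y), ⟨?_, ?_⟩, ?_⟩
    · have h1 : ran (x * sinv y) = e := by
        rw [ran_mul, ran_sinv, hy, ← hx, mul_dom_self, ← hx', ran]
      have h2 : dom (sinv x * w) = e := by
        rw [dom_mul, dom_sinv, hx', ← hw, sinv_mul_ran, hw, ← hw', dom]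
      rw [ran_mul, h1, ← h2, mul_dom_self, ← ran, ran_mul, hw, sinv_sinv, ← hx', sinv_mul_ran,
        ← dom, hx]
    · have h1 : ran (x * sinv y) = e := by
        rw [ran_mul, ran_sinv, hy, ← hx, mul_dom_self, ← hx', ran]
      have h2 : dom (sinv x * w) = e := by
        rw [dom_mul, dom_sinv, hx', ← hw, sinv_mul_ran, hw, ← hw', dom]
      rw [dom_mul, h2, ← h1, sinv_mul_ran, ← dom, dom_mul, sinv_sinv, hx, ← hy, mul_dom_self,
        ← hy', ran]
    · calc x * (sinv x * w * (x * sinv y)) * (y * sinv x)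
          = ran x * w * (x * dom y * sinv x) := by simp only [ran, dom, mul_assoc]
        _ = w * (x * sinv x) := by rw [hx', hy, ← hx, mul_dom_self, ← hw, ran_mul_self]
        _ = w := by
          change w * ran x = w
          rw [hx', ← hw', mul_dom_self]

theorem card_ran_eq [Fintype S] {t e : S} (hte : DRel t e) (he : IsIdempotentElem e)
    {G : Set S} (hG : IsMaximalSubgroupAt e G) :
    (∑ u : S, (open Classical in if ran u = ran t then (1 : ℂ) else 0)) =
      (numIdem t : ℂ) * (G.ncard : ℂ) := by
  classical
  have h1 : ∀ u ∈ ({u : S | ran u = ran t} : Finset S),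
      dom u ∈ ({f : S | IsIdempotentElem f ∧ DRel t f} : Finset S) := by
    intro u hu
    rw [Finset.mem_filter] at hu ⊢
    exact ⟨Finset.mem_univ _, idem_dom u, sinv u, by rw [dom_sinv, hu.2],
      by rw [ran_sinv, ran_of_idem (idem_dom u)]⟩
  rw [Finset.sum_boole, Finset.card_eq_sum_card_fiberwise h1]
  have h2 : ∀ f ∈ ({f : S | IsIdempotentElem f ∧ DRel t f} : Finset S),
      ({u ∈ ({u : S | ran u = ran t} : Finset S) | dom u = f}).card = G.ncard := by
    intro f hf
    rw [Finset.mem_filter] at hf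
    rw [hG.eq_setOf he, ← ncard_ran_dom_eq hte he hf.2.2 hf.2.1, ← Set.ncard_coe_finset]
    congr 1
    ext u
    simp
  rw [Finset.sum_congr rfl h2, Finset.sum_const, smul_eq_mul, Nat.cast_mul, numIdem,
    ← Set.ncard_coe_finset]
  simp

end Counting

/-! ### The inversion formula. -/

theorem sum_moebius_mul_trace {S : Type*} [Semigroup S] [IsInverseSemigroup S] [Fintype S]
    (ρ : MatRep S) (f : MonoidAlgebra ℂ S) (t : S) :
    ∑ v : S with NatLE (sinv v) (sinv t), moebius (sinv v) (sinv t) *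
      Matrix.trace (ρ.fourier f * ρ.val (sinv v)) =
    Matrix.trace (ρ.hom (f * moebiusBasis S (sinv t))) := by
  have hinv : Function.Involutive (sinv : S → S) := sinv_sinv
  rw [moebiusBasis_apply, moebiusElem, map_mul, map_sum, Finset.mul_sum, Matrix.trace_sum,
    Finset.sum_filter, Finset.sum_filter]
  refine Fintype.sum_equiv hinv.toPerm _ _ fun v => ?_
  rw [hinv.coe_toPerm]
  refine if_congr Iff.rfl ?_ rfl
  have h : MonoidAlgebra.single (sinv v) (moebius (sinv v) (sinv t)) =
      moebius (sinv v) (sinv t) • MonoidAlgebra.single (sinv v) (1 : ℂ) := by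
    rw [MonoidAlgebra.smul_single, smul_eq_mul, mul_one]
  rw [h, map_smul, Matrix.mul_smul, Matrix.trace_smul, smul_eq_mul]
  rfl

end InverseSemigroup

theorem theorem3p5 {S : Type*} [Semigroup S] [IsInverseSemigroup S] [Fintype S]
    (X : Set (InverseSemigroup.MatRep S)) (hX : InverseSemigroup.MatRep.IsCompleteSet X)
    (e : S → S) (he : ∀ t : S, IsIdempotentElem (e t) ∧ InverseSemigroup.DRel t (e t))
    (G : S → Set S) (hG : ∀ t : S, InverseSemigroup.IsMaximalSubgroupAt (e t) (G t)) :
    ∃ hfin : X.Finite, ∀ (f : MonoidAlgebra ℂ S) (s : S),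
      f.coeff s = ∑ ρ ∈ hfin.toFinset, (ρ.dim : ℂ) *
        ∑ t : S with InverseSemigroup.NatLE s t,
          (InverseSemigroup.moebius s t / ((InverseSemigroup.numIdem t : ℂ) * ((G t).ncard : ℂ))) *
            ∑ v : S with InverseSemigroup.NatLE (InverseSemigroup.sinv v) (InverseSemigroup.sinv t),
              InverseSemigroup.moebius (InverseSemigroup.sinv v) (InverseSemigroup.sinv t) *
                Matrix.trace (ρ.fourier f * ρ.val (InverseSemigroup.sinv v)) := by
  classical
  obtain ⟨hfin, htr⟩ := hX.exists_finite_sum_trace_eq_regularTrace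
  refine ⟨hfin, fun f s => ?_⟩
  simp_rw [InverseSemigroup.sum_moebius_mul_trace, Finset.mul_sum]
  rw [Finset.sum_comm, InverseSemigroup.coeff_eq_sum_moebius]
  refine Finset.sum_congr rfl fun t _ => ?_
  have h2 := InverseSemigroup.card_ran_eq (he t).2 (he t).1 (hG t)
  have h3 := InverseSemigroup.sum_ran_eq_ne_zero t
  -- Both evaluations of the regular trace at f⌊t⁻¹⌋ are compared; the nonzero factor r(t)|G(t)|
  -- then cancels.
  have h4 := htr (f * InverseSemigroup.moebiusBasis S (InverseSemigroup.sinv t))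
  rw [InverseSemigroup.regularTrace_mul_moebiusBasis_sinv, h2] at h4
  rw [h2] at h3
  simp_rw [mul_left_comm _ (_ / _)]
  rw [← Finset.mul_sum, h4]
  have h5 := left_ne_zero_of_mul h3
  have h6 := right_ne_zero_of_mul h3
  field_simp
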